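/- Let $A\in\mathbf{R}^{m\times n}$, $B\in\mathbf{R}^{\nu\times n}$, $\sigma>0$, and let $S\in\mathbf{R}^{n\times n}$ be symmetric positive semidefinite. One observes $\omega=Ax+\sigma\xi$ with $\xi\sim\mathcal N(0,I_m)$ and unknown $x\in\mathbf{R}^n$, and wants to recover $Bx$. For a Borel estimate $\widehat w:\mathbf{R}^m\to\mathbf{R}^\nu$ define its $S$-risk over $\mathbf{R}^n$ by \[ \mathrm{RiskS}[\widehat w\,|\,\mathbf{R}^n]=\inf\Big\{\sqrt{\tau}:\ \tau\ge 0,\ \mathbf{E}_{\xi\sim\mathcal N(0,I_m)}\big\{\|\widehat w(Ax+\sigma\xi)-Bx\|_2^2\big\}\le\tau(1+x^TSx)\ \ \forall x\in\mathbf{R}^n\Big\} \] (with value $+\infty$ if there is no such $\tau$). Consider the semidefinite program in the variables $\tau\in\mathbf{R}$, $H\in\mathbf{R}^{m\times\nu}$, \[ \mathrm{Opt}=\min_{\tau,H}\left\{\tau:\ \begin{bmatrix}\tau S& B^T-A^TH\\ B-H^TA& I_\nu\end{bmatrix}\succeq 0,\ \ \sigma^2\,\mathrm{Tr}(H^TH)\le\tau\right\}.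 \] Assume that this program is feasible. Then it is solvable (the minimum is attained), and for every optimal solution $(\mathrm{Opt},H_*)$ the linear estimate $\widehat w_{H_*}(\omega)=H_*^T\omega$ is minimax optimal: \[ \mathrm{RiskS}[\widehat w_{H_*}|\mathbf{R}^n]=\sqrt{\mathrm{Opt}}=\inf_{\widehat w(\cdot)}\mathrm{RiskS}[\widehat w(\cdot)|\mathbf{R}^n], \] where the infimum is taken over all Borel functions $\widehat w:\mathbf{R}^m\to\mathbf{R}^\nu$. -/

import Mathlib

open MeasureTheory ProbabilityTheory Matrix
open scoped ENNReal

namespace SRisk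

/-- The linear map `x ↦ M x` between Euclidean spaces given by a `p × q` real matrix. -/
noncomputable def act {p q : ℕ} (M : Matrix (Fin p) (Fin q) ℝ) (x : EuclideanSpace ℝ (Fin q)) :
    EuclideanSpace ℝ (Fin p) :=
  WithLp.toLp 2 (M *ᵥ WithLp.ofLp x)

/-- The quadratic form `xᵀ S x`. -/
noncomputable def quadForm {n : ℕ} (S : Matrix (Fin n) (Fin n) ℝ) (x : EuclideanSpace ℝ (Fin n)) :
    ℝ :=
  WithLp.ofLp x ⬝ᵥ (S *ᵥ WithLp.ofLp x)

/-- The expected squared error `𝔼 ‖ŵ(A x + σ ξ) - B x‖²` with `ξ ∼ 𝒩(0, I_m)`, as an element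
of `[0, ∞]`. -/
noncomputable def expSqError {n m ν : ℕ} (A : Matrix (Fin m) (Fin n) ℝ)
    (B : Matrix (Fin ν) (Fin n) ℝ) (σ : ℝ)
    (w : EuclideanSpace ℝ (Fin m) → EuclideanSpace ℝ (Fin ν))
    (x : EuclideanSpace ℝ (Fin n)) : ℝ≥0∞ :=
  ∫⁻ ξ, ENNReal.ofReal (‖w (act A x + σ • ξ) - act B x‖ ^ 2)
    ∂(stdGaussian (EuclideanSpace ℝ (Fin m)))

/-- The `S`-risk of the estimate `w` on the signal set `X`: the infimum of `√τ` over those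
`τ ≥ 0` with `𝔼 ‖ŵ(A x + σ ξ) - B x‖² ≤ τ (1 + xᵀ S x)` for all `x ∈ X`
(equal to `∞` when there is no such `τ`). -/
noncomputable def riskS {n m ν : ℕ} (A : Matrix (Fin m) (Fin n) ℝ)
    (B : Matrix (Fin ν) (Fin n) ℝ) (S : Matrix (Fin n) (Fin n) ℝ) (σ : ℝ)
    (X : Set (EuclideanSpace ℝ (Fin n)))
    (w : EuclideanSpace ℝ (Fin m) → EuclideanSpace ℝ (Fin ν)) : ℝ≥0∞ :=
  sInf {r : ℝ≥0∞ | ∃ τ : ℝ, 0 ≤ τ ∧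
    (∀ x ∈ X, expSqError A B σ w x ≤ ENNReal.ofReal (τ * (1 + quadForm S x))) ∧
    r = ENNReal.ofReal (Real.sqrt τ)}

/-- The minimax `S`-risk: the infimum of the `S`-risk over all Borel estimates. -/
noncomputable def minimaxRiskS {n m ν : ℕ} (A : Matrix (Fin m) (Fin n) ℝ)
    (B : Matrix (Fin ν) (Fin n) ℝ) (S : Matrix (Fin n) (Fin n) ℝ) (σ : ℝ)
    (X : Set (EuclideanSpace ℝ (Fin n))) : ℝ≥0∞ :=
  ⨅ (w : EuclideanSpace ℝ (Fin m) → EuclideanSpace ℝ (Fin ν)) (_ : Measurable w),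
    riskS A B S σ X w

/-- The linear estimate `ω ↦ Hᵀ ω`. -/
noncomputable def linearEstimate {m ν : ℕ} (H : Matrix (Fin m) (Fin ν) ℝ) :
    EuclideanSpace ℝ (Fin m) → EuclideanSpace ℝ (Fin ν) :=
  fun ω => act Hᵀ ω

/-- Feasibility of `(τ, H)` for the semidefinite program minimizing `τ`. -/
def IsFeasible {n m ν : ℕ} (A : Matrix (Fin m) (Fin n) ℝ)
    (B : Matrix (Fin ν) (Fin n) ℝ) (S : Matrix (Fin n) (Fin n) ℝ) (σ : ℝ)
    (τ : ℝ) (H : Matrix (Fin m) (Fin ν) ℝ) : Prop :=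
  (fromBlocks (τ • S) (Bᵀ - Aᵀ * H) (B - Hᵀ * A)
    (1 : Matrix (Fin ν) (Fin ν) ℝ)).PosSemidef ∧
  σ ^ 2 * (Hᵀ * H).trace ≤ τ

/-- `(τ, H)` is an optimal solution to the program (so that `τ` is its optimal value). -/
def IsOptimalSolution {n m ν : ℕ} (A : Matrix (Fin m) (Fin n) ℝ)
    (B : Matrix (Fin ν) (Fin n) ℝ) (S : Matrix (Fin n) (Fin n) ℝ) (σ : ℝ)
    (τ : ℝ) (H : Matrix (Fin m) (Fin ν) ℝ) : Prop :=
  IsFeasible A B S σ τ H ∧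
    ∀ (τ' : ℝ) (H' : Matrix (Fin m) (Fin ν) ℝ), IsFeasible A B S σ τ' H' → τ ≤ τ'

end SRisk

/-! By a Schur complement, `(τ, H)` is feasible iff `‖(B - Hᵀ A) x‖² ≤ τ xᵀ S x` for all `x` and
`σ² Tr (Hᵀ H) ≤ τ`; the risk of `ω ↦ Hᵀ ω` is then at most `√τ`. Conversely, let a Borel estimate
satisfy the risk bound with some `τ`. Under a Gaussian prior `x ∼ 𝒩(0, Q)` a linear estimate is
Bayes optimal, because a measure-preserving reflection of the pair (signal, noise) fixes the
observation and flips the error of the conditional mean. Averaging the risk bound over the prior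
therefore gives, for each `Q`, some `H` with
`Tr ((B - Hᵀ A) Q (B - Hᵀ A)ᵀ) + σ² Tr (Hᵀ H) ≤ τ (1 + Tr (S Q))`. The left side is convex in `H`
and affine in `Q`, so the minimax theorem of Sion on `{Q | ε Tr (S Q) ≤ 1}` makes `H` independent
of `Q`, and rank-one `Q` show that `((1 + ε) τ, H)` is feasible. Letting `ε → 0`, `Opt ≤ τ`. -/

namespace SRisk

section Minimax

variable {E F β : Type*} [LinearOrder β] [DenselyOrdered β]
  [TopologicalSpace E] [AddCommGroup E] [IsTopologicalAddGroup E] [Module ℝ E] [ContinuousSMul ℝ E]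
  [TopologicalSpace F] [AddCommGroup F] [IsTopologicalAddGroup F] [Module ℝ F] [ContinuousSMul ℝ F]

theorem exists_forall_le_of_forall_exists_le {X : Set E} {Y : Set F} {f : E → F → β} {t : β}
    (hXne : X.Nonempty) (hXcpt : IsCompact X) (hX : Convex ℝ X) (hY : Convex ℝ Y)
    (hlsc : ∀ y ∈ Y, LowerSemicontinuousOn (f · y) X)
    (hconv : ∀ y ∈ Y, QuasiconvexOn ℝ X (f · y))
    (husc : ∀ x ∈ X, UpperSemicontinuousOn (f x) Y)
    (hconc : ∀ x ∈ X, QuasiconcaveOn ℝ Y (f x))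
    (h : ∀ y ∈ Y, ∃ x ∈ X, f x y ≤ t) :
    ∃ x ∈ X, ∀ y ∈ Y, f x y ≤ t := by
  by_contra! hcon
  choose! y hyY hy using hcon
  obtain ⟨s, hsX, hs⟩ := hXcpt.elim_nhdsWithin_subcover (fun x => {z | t < f z (y x)})
    fun x hx => hlsc (y x) (hyY x hx) x hx t (hy x hx)
  obtain ⟨y₀, hy₀Y, hy₀⟩ := Sion.exists_lt_iInf_of_lt_iInf_of_finite hXne hXcpt hlsc hconv hY
    husc hconc hX (s.finite_toSet.image y) (by grind) (t := t) fun x hx => by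
      obtain ⟨x', hx's, hx'⟩ := Set.mem_iUnion₂.1 (hs hx)
      exact ⟨y x', ⟨x', hx's, rfl⟩, hx'⟩
  obtain ⟨x, hxX, hx⟩ := h y₀ hy₀Y
  exact (hy₀ x hxX).not_ge hx

end Minimax

theorem exists_comp_eq_of_ker_le_ker {K V V' V'' : Type*} [DivisionRing K]
    [AddCommGroup V] [AddCommGroup V'] [AddCommGroup V''] [Module K V] [Module K V'] [Module K V'']
    {f : V →ₗ[K] V'} {g : V →ₗ[K] V''} (h : f.ker ≤ g.ker) :
    ∃ k : V' →ₗ[K] V'', k ∘ₗ f = g := by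
  obtain ⟨k, hk⟩ := (f.ker.liftQ g h ∘ₗ f.quotKerEquivRange.symm.toLinearMap).exists_extend
  refine ⟨k, LinearMap.ext fun x => ?_⟩
  simpa using LinearMap.congr_fun hk ⟨f x, f.mem_range_self x⟩

theorem le_one_add_mul_of_forall_mul_le {a q ε τ : ℝ} (hq : 0 ≤ q) (hε : 0 < ε)
    (h : ∀ t, 0 ≤ t → ε * (t * q) ≤ 1 → t * a ≤ τ * (1 + t * q)) : a ≤ (1 + ε) * τ * q := by
  rcases hq.eq_or_lt with rfl | hq
  · by_contra! ha
    rw [mul_zero] at ha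
    have hτ : 0 ≤ τ := by simpa using h 0
    have hlarge := h ((τ + 1) / a) (by positivity) (by simp)
    rw [div_mul_cancel₀ _ ha.ne'] at hlarge
    linarith
  · have hextreme := h (1 / (ε * q)) (by positivity) (by field_simp; rfl)
    field_simp at hextreme
    linarith

theorem lintegral_ofReal_add_const {Ω : Type*} [MeasurableSpace Ω] {μ : Measure Ω}
    [IsProbabilityMeasure μ] {f : Ω → ℝ} (hf : ∀ z, 0 ≤ f z) {c : ℝ} (hc : 0 ≤ c) :
    ∫⁻ z, ENNReal.ofReal (f z + c) ∂μ = ∫⁻ z, ENNReal.ofReal (f z) ∂μ + ENNReal.ofReal c := by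
  simp_rw [ENNReal.ofReal_add (hf _) hc]
  rw [lintegral_add_right _ measurable_const, lintegral_const, measure_univ, mul_one]

theorem map_starProjection_orthogonal_ker {E P : Type*} [NormedAddCommGroup E]
    [InnerProductSpace ℝ E] [FiniteDimensional ℝ E] [AddCommGroup P] [Module ℝ P]
    (L : E →ₗ[ℝ] P) (z : E) :
    L (L.kerᗮ.starProjection z) = L z := by
  have h : z - L.kerᗮ.starProjection z ∈ L.kerᗮᗮ :=
    Submodule.sub_starProjection_mem_orthogonal z
  rw [Submodule.orthogonal_orthogonal, LinearMap.mem_ker, map_sub, sub_eq_zero] at h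
  exact h.symm

theorem lintegral_norm_sq_le_lintegral_norm_add_sq {Ω W : Type*} [MeasurableSpace Ω]
    [NormedAddCommGroup W] [InnerProductSpace ℝ W] [SecondCountableTopology W]
    [MeasurableSpace W] [BorelSpace W] {μ : Measure Ω}
    {R : Ω → Ω} (hR : MeasurePreserving R μ μ) {u e : Ω → W} (hu : Measurable u)
    (he : Measurable e) (huR : ∀ z, u (R z) = u z) (heR : ∀ z, e (R z) = -e z) :
    ∫⁻ z, ENNReal.ofReal (‖e z‖ ^ 2) ∂μ ≤ ∫⁻ z, ENNReal.ofReal (‖u z + e z‖ ^ 2) ∂μ := by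
  have hreflect : ∫⁻ z, ENNReal.ofReal (‖u z - e z‖ ^ 2) ∂μ =
      ∫⁻ z, ENNReal.ofReal (‖u z + e z‖ ^ 2) ∂μ := by
    rw [← hR.lintegral_comp (by fun_prop)]
    simp only [huR, heR, sub_neg_eq_add]
  have hparallelogram : ∀ z, ENNReal.ofReal (‖e z‖ ^ 2) + ENNReal.ofReal (‖e z‖ ^ 2) ≤
      ENNReal.ofReal (‖u z + e z‖ ^ 2) + ENNReal.ofReal (‖u z - e z‖ ^ 2) := fun z => by
    rw [← ENNReal.ofReal_add (by positivity) (by positivity),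
      ← ENNReal.ofReal_add (by positivity) (by positivity)]
    refine ENNReal.ofReal_le_ofReal ?_
    nlinarith [parallelogram_law_with_norm ℝ (u z) (e z), sq_nonneg ‖u z‖]
  have hdouble := lintegral_mono (μ := μ) hparallelogram
  rw [lintegral_add_left (by fun_prop), lintegral_add_left (by fun_prop), hreflect,
    ← two_mul, ← two_mul] at hdouble
  exact (ENNReal.mul_le_mul_iff_right two_ne_zero ENNReal.ofNat_ne_top).1 hdouble

section LinearBayes

variable {E P W : Type*}
  [NormedAddCommGroup E] [InnerProductSpace ℝ E] [FiniteDimensional ℝ E]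
  [MeasurableSpace E] [BorelSpace E]
  [NormedAddCommGroup W] [InnerProductSpace ℝ W] [FiniteDimensional ℝ W]
  [MeasurableSpace W] [BorelSpace W]

theorem exists_linearMap_lintegral_norm_sub_sq_le [NormedAddCommGroup P] [NormedSpace ℝ P]
    [FiniteDimensional ℝ P] [MeasurableSpace P] [BorelSpace P] (L : E →ₗ[ℝ] P) (F : E →ₗ[ℝ] W) :
    ∃ K : P →ₗ[ℝ] W, ∀ w : P → W, Measurable w →
      ∫⁻ z, ENNReal.ofReal (‖K (L z) - F z‖ ^ 2) ∂(stdGaussian E) ≤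
        ∫⁻ z, ENNReal.ofReal (‖w (L z) - F z‖ ^ 2) ∂(stdGaussian E) := by
  let proj : E →L[ℝ] E := L.kerᗮ.starProjection
  obtain ⟨K, hK⟩ : ∃ K : P →ₗ[ℝ] W, K ∘ₗ L = F ∘ₗ proj := by
    refine exists_comp_eq_of_ker_le_ker fun z hz => ?_
    have hproj : proj z = 0 := by
      rw [Submodule.starProjection_apply_eq_zero_iff, Submodule.orthogonal_orthogonal]
      exact hz
    simp [hproj]
  replace hK : ∀ z, K (L z) = F (proj z) := LinearMap.congr_fun hK
  -- `R` preserves the Gaussian law and the observation `L z`, but flips the error `K (L z) - F z`.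
  let R := L.kerᗮ.reflection
  have hR : ∀ z, R z = 2 • proj z - z := L.kerᗮ.reflection_apply
  have hRpres : MeasurePreserving R (stdGaussian E) (stdGaussian E) :=
    ⟨R.continuous.measurable, stdGaussian_map R⟩
  have hLR : ∀ z, L (R z) = L z := fun z => by
    rw [hR, map_sub, map_nsmul, map_starProjection_orthogonal_ker, two_smul, add_sub_cancel_right]
  have hLm : Measurable L := L.continuous_of_finiteDimensional.measurable
  have hFm : Measurable F := F.continuous_of_finiteDimensional.measurable
  have hKm : Measurable K := K.continuous_of_finiteDimensional.measurable
  refine ⟨K, fun w hw => ?_⟩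
  have h := lintegral_norm_sq_le_lintegral_norm_add_sq hRpres
    (u := fun z => w (L z) - K (L z)) (e := fun z => K (L z) - F z) (by fun_prop) (by fun_prop)
    (fun z => by simp only [hLR])
    (fun z => by simp only [hLR]; rw [hR, map_sub, map_nsmul, hK, two_smul]; abel)
  simpa only [sub_add_sub_cancel] using h

variable [NormedAddCommGroup P] [InnerProductSpace ℝ P] [FiniteDimensional ℝ P]
  [MeasurableSpace P] [BorelSpace P]

theorem stdGaussian_prod_map_toLp :
    ((stdGaussian E).prod (stdGaussian P)).map (WithLp.toLp 2) =
      stdGaussian (WithLp 2 (E × P)) := by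
  refine Measure.ext_of_charFun (funext fun t => ?_)
  rw [charFun_prod, charFun_stdGaussian, charFun_stdGaussian, charFun_stdGaussian,
    ← Complex.exp_add, ← Complex.ofReal_pow, ← Complex.ofReal_pow, ← Complex.ofReal_pow,
    WithLp.prod_norm_sq_eq_of_L2]
  push_cast
  congr 1
  simp only [WithLp.fst, WithLp.snd]
  ring

theorem exists_linearMap_lintegral_noisy_norm_sub_sq_le (a : E →ₗ[ℝ] P) (σ : ℝ) (b : E →ₗ[ℝ] W) :
    ∃ K : P →ₗ[ℝ] W, ∀ w : P → W, Measurable w →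
      ∫⁻ η, ∫⁻ ξ, ENNReal.ofReal (‖K (a η + σ • ξ) - b η‖ ^ 2) ∂(stdGaussian P) ∂(stdGaussian E) ≤
        ∫⁻ η, ∫⁻ ξ, ENNReal.ofReal (‖w (a η + σ • ξ) - b η‖ ^ 2)
          ∂(stdGaussian P) ∂(stdGaussian E) := by
  let L : WithLp 2 (E × P) →ₗ[ℝ] P := a ∘ₗ WithLp.fstₗ 2 ℝ E P + σ • WithLp.sndₗ 2 ℝ E P
  let F : WithLp 2 (E × P) →ₗ[ℝ] W := b ∘ₗ WithLp.fstₗ 2 ℝ E P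
  have hLm : Measurable L := L.continuous_of_finiteDimensional.measurable
  have hFm : Measurable F := F.continuous_of_finiteDimensional.measurable
  have hjoint : ∀ w : P → W, Measurable w →
      ∫⁻ z, ENNReal.ofReal (‖w (L z) - F z‖ ^ 2) ∂(stdGaussian (WithLp 2 (E × P))) =
        ∫⁻ η, ∫⁻ ξ, ENNReal.ofReal (‖w (a η + σ • ξ) - b η‖ ^ 2)
          ∂(stdGaussian P) ∂(stdGaussian E) := fun w hw => by
    have hm : Measurable fun z => ENNReal.ofReal (‖w (L z) - F z‖ ^ 2) := by fun_prop
    rw [← stdGaussian_prod_map_toLp, lintegral_map hm (by fun_prop),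
      lintegral_prod _ (by fun_prop)]
    rfl
  obtain ⟨K, hK⟩ := exists_linearMap_lintegral_norm_sub_sq_le L F
  refine ⟨K, fun w hw => ?_⟩
  rw [← hjoint w hw, ← hjoint K K.continuous_of_finiteDimensional.measurable]
  exact hK w hw

end LinearBayes

section SecondMoment

variable {E F ι : Type*} [NormedAddCommGroup E] [InnerProductSpace ℝ E] [CompleteSpace E]
  [MeasurableSpace E] [BorelSpace E] [Fintype ι] {μ : Measure E} [IsProbabilityMeasure μ]

theorem integral_norm_sq_eq_norm_sq_add_sum_covarianceBilin (hμ : MemLp id 2 μ)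
    (b : OrthonormalBasis ι ℝ E) :
    ∫ x, ‖x‖ ^ 2 ∂μ = ‖∫ x, x ∂μ‖ ^ 2 + ∑ i, covarianceBilin μ (b i) (b i) := by
  have hcoord : ∀ i, MemLp (fun x => inner ℝ (b i) x) 2 μ := fun i => hμ.const_inner (b i)
  have hvar : ∀ i, ∫ x, inner ℝ (b i) x ^ 2 ∂μ =
      inner ℝ (b i) (∫ x, x ∂μ) ^ 2 + covarianceBilin μ (b i) (b i) := fun i => by
    have hmean : ∫ x, inner ℝ (b i) x ∂μ = inner ℝ (b i) (∫ x, x ∂μ) :=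
      integral_inner (hμ.integrable one_le_two) (b i)
    rw [covarianceBilin_self hμ, variance_eq_sub (hcoord i), ← hmean, add_sub_cancel]
    rfl
  simp_rw [← b.sum_sq_inner_right]
  rw [integral_finsetSum _ fun i _ => (hcoord i).integrable_sq, ← Finset.sum_add_distrib]
  exact Finset.sum_congr rfl fun i _ => hvar i

theorem integral_norm_const_add_clm_sq [NormedAddCommGroup F] [InnerProductSpace ℝ F]
    [CompleteSpace F] [SecondCountableTopology F] [MeasurableSpace F] [BorelSpace F]
    (hμ : MemLp id 2 μ) (c : F) (T : E →L[ℝ] F) (b : OrthonormalBasis ι ℝ F) :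
    ∫ x, ‖c + T x‖ ^ 2 ∂μ = ‖c + T (∫ x, x ∂μ)‖ ^ 2 +
      ∑ i, covarianceBilin μ (ContinuousLinearMap.adjoint T (b i))
        (ContinuousLinearMap.adjoint T (b i)) := by
  have hcT : Measurable fun x => c + T x := by fun_prop
  have hint : Integrable (fun x => x) μ := hμ.integrable one_le_two
  let ρ := μ.map fun x => c + T x
  have : IsProbabilityMeasure ρ := Measure.isProbabilityMeasure_map hcT.aemeasurable
  have hρ : MemLp id 2 ρ :=
    (memLp_map_measure_iff (by fun_prop) hcT.aemeasurable).2
      ((memLp_const c).add (T.comp_memLp' hμ))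
  have hmean : ∫ y, y ∂ρ = c + T (∫ x, x ∂μ) := by
    rw [integral_map hcT.aemeasurable (by fun_prop),
      integral_add (integrable_const c) (T.integrable_comp hint), T.integral_comp_comm hint]
    simp
  have hcov : covarianceBilin ρ = covarianceBilin (μ.map T) := by
    have : IsProbabilityMeasure (μ.map T) := Measure.isProbabilityMeasure_map (by fun_prop)
    rw [← covarianceBilin_map_const_add (μ := μ.map T) c,
      Measure.map_map (by fun_prop) (by fun_prop)]
    rfl
  rw [← integral_map hcT.aemeasurable (f := fun y => ‖y‖ ^ 2) (by fun_prop),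
    integral_norm_sq_eq_norm_sq_add_sum_covarianceBilin hρ b, hmean, hcov]
  simp only [covarianceBilin_map hμ]

end SecondMoment

section Act

variable {p q : ℕ}

/-- `act M` as a continuous linear map. -/
noncomputable def actCLM (M : Matrix (Fin p) (Fin q) ℝ) :
    EuclideanSpace ℝ (Fin q) →L[ℝ] EuclideanSpace ℝ (Fin p) :=
  (toEuclideanLin M).toContinuousLinearMap

theorem actCLM_apply (M : Matrix (Fin p) (Fin q) ℝ) (x : EuclideanSpace ℝ (Fin q)) :
    actCLM M x = act M x := rfl

theorem adjoint_actCLM (M : Matrix (Fin p) (Fin q) ℝ) :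
    ContinuousLinearMap.adjoint (actCLM M) = actCLM Mᵀ := by
  have h := toEuclideanLin_conjTranspose_eq_adjoint M
  rw [conjTranspose_eq_transpose_of_trivial] at h
  rw [actCLM, actCLM, h]
  rfl

theorem integral_norm_const_add_act_sq_multivariateGaussian {Q : Matrix (Fin q) (Fin q) ℝ}
    (hQ : Q.PosSemidef) (c : EuclideanSpace ℝ (Fin p)) (M : Matrix (Fin p) (Fin q) ℝ) :
    ∫ η, ‖c + act M η‖ ^ 2 ∂(multivariateGaussian 0 Q) = ‖c‖ ^ 2 + (M * Q * Mᵀ).trace := by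
  have h := integral_norm_const_add_clm_sq (μ := multivariateGaussian 0 Q)
    IsGaussian.memLp_two_id c (actCLM M) (EuclideanSpace.basisFun (Fin p) ℝ)
  simp only [adjoint_actCLM, covarianceBilin_multivariateGaussian hQ,
    integral_id_multivariateGaussian, map_zero, add_zero, actCLM_apply] at h
  rw [h, trace, Matrix.mul_assoc]
  congr! 2 with i
  simp [act, mul_apply, mulVec, dotProduct]

theorem lintegral_norm_const_add_act_sq_multivariateGaussian {Q : Matrix (Fin q) (Fin q) ℝ}
    (hQ : Q.PosSemidef) (c : EuclideanSpace ℝ (Fin p)) (M : Matrix (Fin p) (Fin q) ℝ) :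
    ∫⁻ η, ENNReal.ofReal (‖c + act M η‖ ^ 2) ∂(multivariateGaussian 0 Q) =
      ENNReal.ofReal (‖c‖ ^ 2 + (M * Q * Mᵀ).trace) := by
  have hmem : MemLp (fun η => c + act M η) 2 (multivariateGaussian 0 Q) :=
    (memLp_const c).add ((actCLM M).comp_memLp' IsGaussian.memLp_two_id)
  rw [← integral_norm_const_add_act_sq_multivariateGaussian hQ,
    ofReal_integral_eq_lintegral_ofReal (hmem.integrable_norm_pow two_ne_zero)
      (.of_forall fun η => sq_nonneg _)]

end Act

section TraceForm

variable {p q : Type*} [Fintype p] [Fintype q]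

theorem trace_transpose_mul_self_nonneg (H : Matrix p q ℝ) : 0 ≤ (Hᵀ * H).trace := by
  have h := (posSemidef_conjTranspose_mul_self H).trace_nonneg
  rwa [conjTranspose_eq_transpose_of_trivial] at h

theorem sq_mul_trace_nonneg (σ : ℝ) (H : Matrix p q ℝ) : 0 ≤ σ ^ 2 * (Hᵀ * H).trace :=
  mul_nonneg (sq_nonneg σ) (trace_transpose_mul_self_nonneg H)

theorem sq_apply_le_trace_transpose_mul_self (H : Matrix p q ℝ) (i : p) (j : q) :
    H i j ^ 2 ≤ (Hᵀ * H).trace := by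
  have htrace : (Hᵀ * H).trace = ∑ j, ∑ i, H i j ^ 2 := by simp [trace, mul_apply, sq]
  rw [htrace]
  calc H i j ^ 2 ≤ ∑ i, H i j ^ 2 :=
        Finset.single_le_sum (f := fun i => H i j ^ 2) (fun _ _ => sq_nonneg _) (Finset.mem_univ i)
    _ ≤ ∑ j, ∑ i, H i j ^ 2 :=
        Finset.single_le_sum (f := fun j => ∑ i, H i j ^ 2)
          (fun _ _ => Finset.sum_nonneg fun _ _ => sq_nonneg _) (Finset.mem_univ j)

theorem isCompact_setOf_trace_transpose_mul_self_le (c : ℝ) :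
    IsCompact {H : Matrix p q ℝ | (Hᵀ * H).trace ≤ c} := by
  have hbox : IsCompact (Set.univ.pi fun _ : p => Set.univ.pi fun _ : q =>
      Set.Icc (-√c) √c) :=
    isCompact_univ_pi fun _ => isCompact_univ_pi fun _ => isCompact_Icc
  refine hbox.of_isClosed_subset (isClosed_le (by fun_prop) continuous_const) ?_
  intro H hH i _ j _
  exact abs_le.1 (Real.abs_le_sqrt ((sq_apply_le_trace_transpose_mul_self H i j).trans hH))

theorem isCompact_setOf_sq_mul_trace_le {σ : ℝ} (hσ : σ ≠ 0) (c : ℝ) :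
    IsCompact {H : Matrix p q ℝ | σ ^ 2 * (Hᵀ * H).trace ≤ c} := by
  have hσ2 : 0 < σ ^ 2 := by positivity
  convert isCompact_setOf_trace_transpose_mul_self_le (p := p) (q := q) (c / σ ^ 2) using 3
  rw [le_div_iff₀' hσ2]

theorem trace_mul_mul_transpose_nonneg {Q : Matrix q q ℝ} (hQ : Q.PosSemidef)
    (N : Matrix p q ℝ) : 0 ≤ (N * Q * Nᵀ).trace := by
  have h := (hQ.mul_mul_conjTranspose_same N).trace_nonneg
  rwa [conjTranspose_eq_transpose_of_trivial] at h

theorem convexOn_trace_mul_mul_transpose {Q : Matrix q q ℝ} (hQ : Q.PosSemidef) :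
    ConvexOn ℝ Set.univ fun N : Matrix p q ℝ => (N * Q * Nᵀ).trace := by
  refine ⟨convex_univ, fun X _ Y _ a b ha hb hab => ?_⟩
  have hgap : a * (X * Q * Xᵀ).trace + b * (Y * Q * Yᵀ).trace -
      ((a • X + b • Y) * Q * (a • X + b • Y)ᵀ).trace =
        a * b * ((X - Y) * Q * (X - Y)ᵀ).trace := by
    obtain rfl : b = 1 - a := by linarith
    simp only [transpose_add, transpose_sub, transpose_smul, Matrix.add_mul, Matrix.mul_add,
      Matrix.sub_mul, Matrix.mul_sub, Matrix.smul_mul, Matrix.mul_smul, trace_add, trace_sub,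
      trace_smul, smul_eq_mul]
    ring
  have hnonneg := mul_nonneg (mul_nonneg ha hb) (trace_mul_mul_transpose_nonneg hQ (X - Y))
  simp only [smul_eq_mul]
  linarith

theorem convexOn_trace_transpose_mul_self :
    ConvexOn ℝ Set.univ fun H : Matrix p q ℝ => (Hᵀ * H).trace := by
  classical
  simpa [Function.comp_def] using
    (convexOn_trace_mul_mul_transpose (p := q) PosSemidef.one).comp_linearMap
    (transposeLinearEquiv p q ℝ ℝ).toLinearMap

open scoped MatrixOrder in
theorem exists_eq_transpose_mul_self {S : Matrix p p ℝ} (hS : S.PosSemidef) :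
    ∃ R : Matrix p p ℝ, S = Rᵀ * R := by
  classical
  obtain ⟨R, rfl⟩ := CStarAlgebra.nonneg_iff_eq_star_mul_self.mp hS.nonneg
  exact ⟨R, rfl⟩

theorem trace_mul_nonneg_of_posSemidef {S Q : Matrix p p ℝ} (hS : S.PosSemidef)
    (hQ : Q.PosSemidef) : 0 ≤ (S * Q).trace := by
  obtain ⟨R, rfl⟩ := exists_eq_transpose_mul_self hS
  rw [Matrix.mul_assoc, trace_mul_comm]
  exact trace_mul_mul_transpose_nonneg hQ R

theorem convex_setOf_posSemidef_trace_le (S : Matrix q q ℝ) (ε : ℝ) :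
    Convex ℝ {Q : Matrix q q ℝ | Q.PosSemidef ∧ ε * (S * Q).trace ≤ 1} := by
  rintro Q ⟨hQ, hQle⟩ Q' ⟨hQ', hQle'⟩ a b ha hb hab
  refine ⟨(hQ.smul ha).add (hQ'.smul hb), ?_⟩
  simp only [Matrix.mul_add, Matrix.mul_smul, trace_add, trace_smul, smul_eq_mul]
  linarith [mul_le_mul_of_nonneg_left hQle ha, mul_le_mul_of_nonneg_left hQle' hb]

end TraceForm

section QuadForm

variable {p q : ℕ}

theorem norm_act_sq (M : Matrix (Fin p) (Fin q) ℝ) (x : EuclideanSpace ℝ (Fin q)) :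
    ‖act M x‖ ^ 2 = quadForm (Mᵀ * M) x := by
  rw [EuclideanSpace.real_norm_sq_eq, quadForm, ← mulVec_mulVec, dotProduct_mulVec,
    vecMul_transpose]
  simp only [act, dotProduct, sq]

theorem quadForm_nonneg {S : Matrix (Fin p) (Fin p) ℝ} (hS : S.PosSemidef)
    (x : EuclideanSpace ℝ (Fin p)) : 0 ≤ quadForm S x :=
  hS.dotProduct_mulVec_nonneg (WithLp.ofLp x)

theorem quadForm_smul (c : ℝ) (S : Matrix (Fin p) (Fin p) ℝ) (x : EuclideanSpace ℝ (Fin p)) :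
    quadForm (c • S) x = c * quadForm S x := by
  rw [quadForm, smul_mulVec, dotProduct_smul, smul_eq_mul, quadForm]

theorem quadForm_sub (S T : Matrix (Fin p) (Fin p) ℝ) (x : EuclideanSpace ℝ (Fin p)) :
    quadForm (S - T) x = quadForm S x - quadForm T x := by
  rw [quadForm, sub_mulVec, dotProduct_sub, quadForm, quadForm]

theorem trace_mul_vecMulVec_self (S : Matrix (Fin p) (Fin p) ℝ) (x : EuclideanSpace ℝ (Fin p)) :
    (S * vecMulVec x x).trace = quadForm S x := by
  rw [mul_vecMulVec, trace_vecMulVec, dotProduct_comm, quadForm]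

theorem trace_mul_vecMulVec_self_mul_transpose (M : Matrix (Fin p) (Fin q) ℝ)
    (x : EuclideanSpace ℝ (Fin q)) : (M * vecMulVec x x * Mᵀ).trace = ‖act M x‖ ^ 2 := by
  rw [trace_mul_cycle, trace_mul_vecMulVec_self, norm_act_sq]

theorem posSemidef_fromBlocks_one_iff {P : Matrix (Fin q) (Fin q) ℝ} (hP : P.IsHermitian)
    (M : Matrix (Fin p) (Fin q) ℝ) :
    (fromBlocks P Mᵀ M 1).PosSemidef ↔ ∀ x, ‖act M x‖ ^ 2 ≤ quadForm P x := by
  let : Invertible (1 : Matrix (Fin p) (Fin p) ℝ) := invertibleOne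
  have hM : Mᵀᴴ = M := by simp [conjTranspose_eq_transpose_of_trivial]
  have hschur := PosDef.fromBlocks₂₂ P Mᵀ (PosDef.one (n := Fin p) (R := ℝ))
  rw [hM, inv_one, Matrix.mul_one] at hschur
  have hherm : (P - Mᵀ * M).IsHermitian := by
    have h := hP.sub (isHermitian_conjTranspose_mul_self M)
    rwa [conjTranspose_eq_transpose_of_trivial] at h
  rw [hschur, posSemidef_iff_dotProduct_mulVec, and_iff_right hherm]
  simp_rw [norm_act_sq, ← sub_nonneg (a := quadForm P _), ← quadForm_sub]
  exact ((WithLp.toLp_surjective 2).forall (p := fun x => 0 ≤ quadForm (P - Mᵀ * M) x)).symm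

theorem lintegral_quadForm_multivariateGaussian {S Q : Matrix (Fin p) (Fin p) ℝ}
    (hS : S.PosSemidef) (hQ : Q.PosSemidef) :
    ∫⁻ x, ENNReal.ofReal (quadForm S x) ∂(multivariateGaussian 0 Q) =
      ENNReal.ofReal (S * Q).trace := by
  obtain ⟨R, rfl⟩ := exists_eq_transpose_mul_self hS
  have h := lintegral_norm_const_add_act_sq_multivariateGaussian hQ 0 R
  rw [Matrix.mul_assoc, trace_mul_comm]
  simpa [norm_act_sq] using h

end QuadForm

section Estimation

variable {n m ν : ℕ} {A : Matrix (Fin m) (Fin n) ℝ} {B : Matrix (Fin ν) (Fin n) ℝ}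
  {S Q : Matrix (Fin n) (Fin n) ℝ} {σ τ : ℝ} {H : Matrix (Fin m) (Fin ν) ℝ}
  {w : EuclideanSpace ℝ (Fin m) → EuclideanSpace ℝ (Fin ν)}

theorem isFeasible_iff (hS : S.IsHermitian) :
    IsFeasible A B S σ τ H ↔
      (∀ x, ‖act (B - Hᵀ * A) x‖ ^ 2 ≤ τ * quadForm S x) ∧ σ ^ 2 * (Hᵀ * H).trace ≤ τ := by
  have hcorner : Bᵀ - Aᵀ * H = (B - Hᵀ * A)ᵀ := by simp [transpose_mul]
  simp_rw [← quadForm_smul]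
  rw [← posSemidef_fromBlocks_one_iff (hS.smul (.all τ)), ← hcorner]
  rfl

theorem IsFeasible.nonneg (h : IsFeasible A B S σ τ H) : 0 ≤ τ :=
  (sq_mul_trace_nonneg σ H).trans h.2

theorem isClosed_setOf_isFeasible (hS : S.IsHermitian) :
    IsClosed {p : ℝ × Matrix (Fin m) (Fin ν) ℝ | IsFeasible A B S σ p.1 p.2} := by
  simp only [isFeasible_iff hS, norm_act_sq, quadForm, Set.ofPred_and, Set.ofPred_forall]
  exact (isClosed_iInter fun x => isClosed_le (by fun_prop) (by fun_prop)).inter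
    (isClosed_le (by fun_prop) (by fun_prop))

theorem exists_isOptimalSolution (hS : S.IsHermitian) (hσ : σ ≠ 0)
    (hfeas : ∃ (τ : ℝ) (H : Matrix (Fin m) (Fin ν) ℝ), IsFeasible A B S σ τ H) :
    ∃ (τ : ℝ) (H : Matrix (Fin m) (Fin ν) ℝ), IsOptimalSolution A B S σ τ H := by
  obtain ⟨τ₀, H₀, h₀⟩ := hfeas
  have hcompact := ((isCompact_Icc (a := 0) (b := τ₀)).prod
    (isCompact_setOf_sq_mul_trace_le hσ τ₀)).inter_right
      (isClosed_setOf_isFeasible (A := A) (B := B) (σ := σ) hS)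
  obtain ⟨⟨τ, H⟩, ⟨⟨hτ, -⟩, hF⟩, hmin⟩ := hcompact.exists_isMinOn
    ⟨(τ₀, H₀), ⟨⟨h₀.nonneg, le_rfl⟩, h₀.2⟩, h₀⟩ continuous_fst.continuousOn
  refine ⟨τ, H, hF, fun τ' H' h' => ?_⟩
  rcases le_or_gt τ' τ₀ with hle | hlt
  · exact hmin (a := (τ', H')) ⟨⟨⟨h'.nonneg, hle⟩, h'.2.trans hle⟩, h'⟩
  · exact hτ.2.trans hlt.le

theorem expSqError_linearEstimate (H : Matrix (Fin m) (Fin ν) ℝ)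
    (x : EuclideanSpace ℝ (Fin n)) :
    expSqError A B σ (linearEstimate H) x =
      ENNReal.ofReal (‖act (B - Hᵀ * A) x‖ ^ 2 + σ ^ 2 * (Hᵀ * H).trace) := by
  have herror : ∀ ξ, linearEstimate H (act A x + σ • ξ) - act B x =
      -act (B - Hᵀ * A) x + act (σ • Hᵀ) ξ := fun ξ => by
    ext i
    simp only [linearEstimate, act, WithLp.ofLp_add, WithLp.ofLp_smul, mulVec_add, mulVec_mulVec,
      mulVec_smul, PiLp.sub_apply, PiLp.add_apply, PiLp.neg_apply, Pi.add_apply, Pi.smul_apply,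
      Pi.sub_apply, smul_eq_mul, sub_mulVec, smul_mulVec]
    ring
  have hnoise : ((σ • Hᵀ) * (1 : Matrix (Fin m) (Fin m) ℝ) * (σ • Hᵀ)ᵀ).trace =
      σ ^ 2 * (Hᵀ * H).trace := by
    simp [sq, mul_assoc]
  simp only [expSqError, herror]
  rw [← multivariateGaussian_zero_one,
    lintegral_norm_const_add_act_sq_multivariateGaussian PosSemidef.one, norm_neg, hnoise]

theorem riskS_linearEstimate_le (hS : S.IsHermitian) (h : IsFeasible A B S σ τ H) :
    riskS A B S σ Set.univ (linearEstimate H) ≤ ENNReal.ofReal √τ := by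
  refine sInf_le ⟨τ, h.nonneg, fun x _ => ?_, rfl⟩
  obtain ⟨hbias, hnoise⟩ := (isFeasible_iff hS).1 h
  rw [expSqError_linearEstimate]
  exact ENNReal.ofReal_le_ofReal (by linarith [hbias x])

/-- The Bayes risk of the linear estimate `ω ↦ Hᵀ ω` under the prior `x ∼ 𝒩(0, Q)`. -/
noncomputable def linearBayesRisk (A : Matrix (Fin m) (Fin n) ℝ) (B : Matrix (Fin ν) (Fin n) ℝ)
    (σ : ℝ) (Q : Matrix (Fin n) (Fin n) ℝ) (H : Matrix (Fin m) (Fin ν) ℝ) : ℝ :=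
  ((B - Hᵀ * A) * Q * (B - Hᵀ * A)ᵀ).trace + σ ^ 2 * (Hᵀ * H).trace

theorem lintegral_expSqError_linearEstimate (hQ : Q.PosSemidef) :
    ∫⁻ x, expSqError A B σ (linearEstimate H) x ∂(multivariateGaussian 0 Q) =
      ENNReal.ofReal (linearBayesRisk A B σ Q H) := by
  have hbias := lintegral_norm_const_add_act_sq_multivariateGaussian hQ 0 (B - Hᵀ * A)
  simp only [zero_add, norm_zero, ne_eq, OfNat.ofNat_ne_zero, not_false_eq_true, zero_pow] at hbias
  have hnoise : 0 ≤ σ ^ 2 * (Hᵀ * H).trace := sq_mul_trace_nonneg σ H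
  simp_rw [expSqError_linearEstimate]
  rw [lintegral_ofReal_add_const (fun _ => sq_nonneg _) hnoise, hbias, linearBayesRisk,
    ENNReal.ofReal_add (trace_mul_mul_transpose_nonneg hQ _) hnoise]

theorem measurable_expSqError (hw : Measurable w) : Measurable (expSqError A B σ w) := by
  have hA : Measurable (act A) := (actCLM A).continuous.measurable
  have hB : Measurable (act B) := (actCLM B).continuous.measurable
  exact Measurable.lintegral_prod_right' (f := fun z : EuclideanSpace ℝ (Fin n) × _ =>
    ENNReal.ofReal (‖w (act A z.1 + σ • z.2) - act B z.1‖ ^ 2)) (by fun_prop)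

open scoped MatrixOrder in
theorem exists_lintegral_expSqError_linearEstimate_le (A : Matrix (Fin m) (Fin n) ℝ)
    (B : Matrix (Fin ν) (Fin n) ℝ) (σ : ℝ) (Q : Matrix (Fin n) (Fin n) ℝ) :
    ∃ H : Matrix (Fin m) (Fin ν) ℝ, ∀ w, Measurable w →
      ∫⁻ x, expSqError A B σ (linearEstimate H) x ∂(multivariateGaussian 0 Q) ≤
        ∫⁻ x, expSqError A B σ w x ∂(multivariateGaussian 0 Q) := by
  let T := toEuclideanCLM (n := Fin n) (𝕜 := ℝ) (CFC.sqrt Q)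
  have hprior : ∀ w : EuclideanSpace ℝ (Fin m) → EuclideanSpace ℝ (Fin ν), Measurable w →
      ∫⁻ x, expSqError A B σ w x ∂(multivariateGaussian 0 Q) =
        ∫⁻ η, expSqError A B σ w (T η) ∂(stdGaussian (EuclideanSpace ℝ (Fin n))) := fun w hw => by
    simp_rw [multivariateGaussian, zero_add]
    exact lintegral_map (measurable_expSqError hw) T.continuous.measurable
  obtain ⟨K, hK⟩ := exists_linearMap_lintegral_noisy_norm_sub_sq_le
    (toEuclideanLin A ∘ₗ T.toLinearMap) σ (toEuclideanLin B ∘ₗ T.toLinearMap)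
  have hlinear : linearEstimate (toEuclideanLin.symm K)ᵀ = K := by
    ext1 ω
    rw [linearEstimate, transpose_transpose]
    exact LinearMap.congr_fun (toEuclideanLin.apply_symm_apply K) ω
  refine ⟨(toEuclideanLin.symm K)ᵀ, fun w hw => ?_⟩
  rw [hlinear, hprior w hw, hprior K K.continuous_of_finiteDimensional.measurable]
  exact hK w hw

theorem exists_linearBayesRisk_le (hS : S.PosSemidef) (hQ : Q.PosSemidef) (hw : Measurable w)
    (hτ : 0 ≤ τ)
    (h : ∀ x, expSqError A B σ w x ≤ ENNReal.ofReal (τ * (1 + quadForm S x))) :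
    ∃ H, linearBayesRisk A B σ Q H ≤ τ * (1 + (S * Q).trace) := by
  obtain ⟨H, hH⟩ := exists_lintegral_expSqError_linearEstimate_le A B σ Q
  refine ⟨H, (ENNReal.ofReal_le_ofReal_iff ?_).1 ?_⟩
  · have hSQ := trace_mul_nonneg_of_posSemidef hS hQ
    positivity
  have hτS : (τ • S).PosSemidef := hS.smul hτ
  calc ENNReal.ofReal (linearBayesRisk A B σ Q H)
      = ∫⁻ x, expSqError A B σ (linearEstimate H) x ∂(multivariateGaussian 0 Q) :=
        (lintegral_expSqError_linearEstimate hQ).symm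
    _ ≤ ∫⁻ x, expSqError A B σ w x ∂(multivariateGaussian 0 Q) := hH w hw
    _ ≤ ∫⁻ x, ENNReal.ofReal (quadForm (τ • S) x + τ) ∂(multivariateGaussian 0 Q) :=
        lintegral_mono fun x => (h x).trans_eq (by rw [quadForm_smul]; ring_nf)
    _ = ENNReal.ofReal (τ * (1 + (S * Q).trace)) := by
        rw [lintegral_ofReal_add_const (quadForm_nonneg hτS) hτ,
          lintegral_quadForm_multivariateGaussian hτS hQ,
          ← ENNReal.ofReal_add (trace_mul_nonneg_of_posSemidef hτS hQ) hτ, Matrix.smul_mul,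
          trace_smul, smul_eq_mul]
        ring_nf

theorem sq_mul_trace_le_linearBayesRisk (hQ : Q.PosSemidef) :
    σ ^ 2 * (Hᵀ * H).trace ≤ linearBayesRisk A B σ Q H :=
  le_add_of_nonneg_left (trace_mul_mul_transpose_nonneg hQ _)

theorem convexOn_linearBayesRisk (hQ : Q.PosSemidef) :
    ConvexOn ℝ Set.univ (linearBayesRisk A B σ Q) := by
  let bias : Matrix (Fin m) (Fin ν) ℝ →ᵃ[ℝ] Matrix (Fin ν) (Fin n) ℝ :=
    AffineMap.const ℝ _ B - ((mulRightLinearMap (Fin ν) ℝ A) ∘ₗ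
      (transposeLinearEquiv (Fin m) (Fin ν) ℝ ℝ).toLinearMap).toAffineMap
  exact ((convexOn_trace_mul_mul_transpose hQ).comp_affineMap bias).add
    (convexOn_trace_transpose_mul_self.smul (sq_nonneg σ))

theorem continuous_linearBayesRisk : Continuous (linearBayesRisk A B σ Q) := by
  unfold linearBayesRisk
  fun_prop

theorem continuous_linearBayesRisk_prior :
    Continuous fun Q => linearBayesRisk A B σ Q H := by
  unfold linearBayesRisk
  fun_prop

theorem concaveOn_linearBayesRisk_sub :
    ConcaveOn ℝ Set.univ fun Q => linearBayesRisk A B σ Q H - τ * (1 + (S * Q).trace) := by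
  refine ⟨convex_univ, fun Q _ Q' _ a b _ _ hab => le_of_eq ?_⟩
  obtain rfl : b = 1 - a := by linarith
  simp only [linearBayesRisk, Matrix.mul_add, Matrix.add_mul, Matrix.mul_smul, Matrix.smul_mul,
    trace_add, trace_smul, smul_eq_mul]
  ring

theorem linearBayesRisk_smul_vecMulVec_self (t : ℝ) (x : EuclideanSpace ℝ (Fin n)) :
    linearBayesRisk A B σ (t • vecMulVec x x) H =
      t * ‖act (B - Hᵀ * A) x‖ ^ 2 + σ ^ 2 * (Hᵀ * H).trace := by
  rw [linearBayesRisk, Matrix.mul_smul, Matrix.smul_mul, trace_smul,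
    trace_mul_vecMulVec_self_mul_transpose, smul_eq_mul]

theorem isFeasible_of_linearBayesRisk_le {ε : ℝ} (hS : S.PosSemidef) (hε : 0 < ε) (hτ : 0 ≤ τ)
    (h : ∀ Q : Matrix (Fin n) (Fin n) ℝ, Q.PosSemidef → ε * (S * Q).trace ≤ 1 →
      linearBayesRisk A B σ Q H ≤ τ * (1 + (S * Q).trace)) :
    IsFeasible A B S σ ((1 + ε) * τ) H := by
  have hrankOne : ∀ (x : EuclideanSpace ℝ (Fin n)) (t : ℝ), 0 ≤ t → ε * (t * quadForm S x) ≤ 1 →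
      t * ‖act (B - Hᵀ * A) x‖ ^ 2 + σ ^ 2 * (Hᵀ * H).trace ≤ τ * (1 + t * quadForm S x) := by
    intro x t ht hle
    have hpos : (t • vecMulVec x x : Matrix (Fin n) (Fin n) ℝ).PosSemidef :=
      (posSemidef_vecMulVec_self_star (x : Fin n → ℝ)).smul ht
    have htrace : (S * t • vecMulVec x x).trace = t * quadForm S x := by
      rw [Matrix.mul_smul, trace_smul, trace_mul_vecMulVec_self, smul_eq_mul]
    simpa only [linearBayesRisk_smul_vecMulVec_self, htrace] using h _ hpos (htrace ▸ hle)
  have hnoise : 0 ≤ σ ^ 2 * (Hᵀ * H).trace := sq_mul_trace_nonneg σ H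
  refine (isFeasible_iff hS.isHermitian).2 ⟨fun x => ?_, ?_⟩
  · exact le_one_add_mul_of_forall_mul_le (quadForm_nonneg hS x) hε fun t ht hle => by
      linarith [hrankOne x t ht hle]
  · have hzero := hrankOne 0 0 le_rfl (by simp)
    simp only [zero_mul, zero_add, add_zero, mul_one] at hzero
    exact hzero.trans (le_mul_of_one_le_left hτ (by linarith))

theorem exists_isFeasible_of_expSqError_le {ε : ℝ} (hS : S.PosSemidef) (hσ : σ ≠ 0) (hε : 0 < ε)
    (hw : Measurable w) (hτ : 0 ≤ τ)
    (h : ∀ x, expSqError A B σ w x ≤ ENNReal.ofReal (τ * (1 + quadForm S x))) :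
    ∃ H, IsFeasible A B S σ ((1 + ε) * τ) H := by
  -- Bounding `Tr (S Q)` confines the Bayes optimal `H` to a compact set, as minimax requires.
  let X : Set (Matrix (Fin m) (Fin ν) ℝ) := {H | σ ^ 2 * (Hᵀ * H).trace ≤ τ * (1 + ε⁻¹)}
  let Y : Set (Matrix (Fin n) (Fin n) ℝ) := {Q | Q.PosSemidef ∧ ε * (S * Q).trace ≤ 1}
  let excess (H : Matrix (Fin m) (Fin ν) ℝ) (Q : Matrix (Fin n) (Fin n) ℝ) : ℝ :=
    linearBayesRisk A B σ Q H - τ * (1 + (S * Q).trace)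
  have hXne : X.Nonempty := ⟨0, by simpa [X] using by positivity⟩
  have hX : Convex ℝ X := by
    simpa using (convexOn_trace_transpose_mul_self.smul (sq_nonneg σ)).convex_le (τ * (1 + ε⁻¹))
  have hY : Convex ℝ Y := convex_setOf_posSemidef_trace_le S ε
  have hlsc : ∀ Q ∈ Y, LowerSemicontinuousOn (excess · Q) X := fun Q _ =>
    (continuous_linearBayesRisk.sub continuous_const).continuousOn.lowerSemicontinuousOn
  have hconv : ∀ Q ∈ Y, QuasiconvexOn ℝ X (excess · Q) := fun Q hQ =>
    (((convexOn_linearBayesRisk hQ.1).add_const _).subset (Set.subset_univ _) hX).quasiconvexOn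
  have husc : ∀ H ∈ X, UpperSemicontinuousOn (excess H) Y := fun H _ =>
    (continuous_linearBayesRisk_prior.sub (by fun_prop)).continuousOn.upperSemicontinuousOn
  have hconc : ∀ H ∈ X, QuasiconcaveOn ℝ Y (excess H) := fun H _ =>
    (concaveOn_linearBayesRisk_sub.subset (Set.subset_univ _) hY).quasiconcaveOn
  have hbayes : ∀ Q ∈ Y, ∃ H ∈ X, excess H Q ≤ 0 := by
    rintro Q ⟨hQ, hQle⟩
    obtain ⟨H, hH⟩ := exists_linearBayesRisk_le hS hQ hw hτ h
    refine ⟨H, ?_, sub_nonpos.2 hH⟩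
    calc σ ^ 2 * (Hᵀ * H).trace ≤ linearBayesRisk A B σ Q H := sq_mul_trace_le_linearBayesRisk hQ
      _ ≤ τ * (1 + (S * Q).trace) := hH
      _ ≤ τ * (1 + ε⁻¹) := by
        gcongr
        rwa [← mul_le_mul_iff_right₀ hε, mul_inv_cancel₀ hε.ne']
  obtain ⟨H, -, hH⟩ := exists_forall_le_of_forall_exists_le hXne
    (isCompact_setOf_sq_mul_trace_le hσ _) hX hY hlsc hconv husc hconc hbayes
  exact ⟨H, isFeasible_of_linearBayesRisk_le hS hε hτ fun Q hQ hQle =>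
    sub_nonpos.1 (hH Q ⟨hQ, hQle⟩)⟩

theorem IsOptimalSolution.ofReal_sqrt_le_riskS (h : IsOptimalSolution A B S σ τ H)
    (hS : S.PosSemidef) (hσ : σ ≠ 0) (hw : Measurable w) :
    ENNReal.ofReal √τ ≤ riskS A B S σ Set.univ w := by
  refine le_sInf ?_
  rintro _ ⟨τ', hτ', hle, rfl⟩
  refine ENNReal.ofReal_le_ofReal (Real.sqrt_le_sqrt ?_)
  refine (le_iff_forall_one_lt_le_mul₀ hτ').2 fun r hr => ?_
  obtain ⟨H', hH'⟩ := exists_isFeasible_of_expSqError_le hS hσ (sub_pos.2 hr) hw hτ'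
    fun x => hle x trivial
  simpa [mul_comm] using h.2 _ _ hH'

end Estimation

end SRisk

theorem proposition2 (n m ν : ℕ) (A : Matrix (Fin m) (Fin n) ℝ)
    (B : Matrix (Fin ν) (Fin n) ℝ) (S : Matrix (Fin n) (Fin n) ℝ) (hS : S.PosSemidef)
    (σ : ℝ) (hσ : 0 < σ)
    (hfeas : ∃ (τ : ℝ) (H : Matrix (Fin m) (Fin ν) ℝ), SRisk.IsFeasible A B S σ τ H) :
    (∃ (Opt : ℝ) (H : Matrix (Fin m) (Fin ν) ℝ), SRisk.IsOptimalSolution A B S σ Opt H) ∧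
    ∀ (Opt : ℝ) (H : Matrix (Fin m) (Fin ν) ℝ), SRisk.IsOptimalSolution A B S σ Opt H →
      SRisk.riskS A B S σ Set.univ (SRisk.linearEstimate H) = ENNReal.ofReal (Real.sqrt Opt) ∧
      SRisk.minimaxRiskS A B S σ Set.univ = ENNReal.ofReal (Real.sqrt Opt) := by
  have hσ' := hσ.ne'
  refine ⟨SRisk.exists_isOptimalSolution hS.isHermitian hσ' hfeas, fun Opt H hH => ?_⟩
  have hupper := SRisk.riskS_linearEstimate_le hS.isHermitian hH.1
  have hlower : ∀ w, Measurable w → ENNReal.ofReal √Opt ≤ SRisk.riskS A B S σ Set.univ w :=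
    fun w hw => hH.ofReal_sqrt_le_riskS hS hσ' hw
  have hmeas : Measurable (SRisk.linearEstimate H) :=
    (SRisk.actCLM Hᵀ).continuous.measurable
  exact ⟨le_antisymm hupper (hlower _ hmeas),
    le_antisymm ((iInf₂_le _ hmeas).trans hupper) (le_iInf₂ hlower)⟩
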